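/- Let $\mathbb{T}$ be the unit circle with normalized Lebesgue measure, let $P$ be the orthogonal projection of $L^2(\mathbb{T})$ onto the Hardy space $H^2$, let $M_a$ be multiplication by $a\in L^\infty(\mathbb{T})$ on $L^2(\mathbb{T})$, let $(Jf)(t)=t^{-1}f(t^{-1})$ on $L^2(\mathbb{T})$, and let $H(a):=PM_aJ|_{H^2}:H^2\to H^2$ be the Hankel operator with symbol $a$. Let $(\lambda_k)_{k\ge1}$ be a sequence of points with $|\lambda_k|<1$ and $\sum_{k}(1-|\lambda_k|)<\infty$. Put $b_0(z)=z$ and $b_\lambda(z)=\frac{\lambda-z}{1-\overline{\lambda}z}\,\frac{|\lambda|}{\lambda}$ for $0<|\lambda|<1$, and let $u=\prod_{k=1}^\infty b_{\lambda_k}$ be the Blaschke product and $u_n=\prod_{k=1}^n b_{\lambda_k}$ its partial products. The infinite product converges in the unit disk, and $u$ and the $u_n$ have non-tangential boundary values almost everywhere on $\mathbb{T}$, which define functions in $L^\infty(\mathbb{T})$, denoted by the same letters. Let $P_{u_n}$ be the orthogonal projection of $L^2(\mathbb{T})$ onto $K^2_{u_n}=H^2\ominus u_nH^2$, and set $R_{u_n}:=P_{u_n}M_{u_n}J$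 on $L^2(\mathbb{T})$. Then, when an operator $A$ on $H^2$ is identified with the operator on $L^2(\mathbb{T})$ that equals $A$ on $H^2$ and $0$ on $(H^2)^\perp$, one has $R_{u_n}=H(u_n)$ for every $n$, and $R_{u_n}=H(u_n)\to H(u)$ $^*$-strongly as $n\to\infty$, that is, $H(u_n)x\to H(u)x$ and $H(u_n)^*x\to H(u)^*x$ in norm for every $x\in H^2$, and likewise $R_{u_n}f\to H(u)f$ and $R_{u_n}^*f\to H(u)^*f$ for every $f\in L^2(\mathbb{T})$. In contrast, the classical operators $R_n=H(t^n)$ on $H^2$ tend weakly to zero. -/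

import Mathlib

open MeasureTheory Filter Topology

namespace HankelBlaschke

noncomputable section

/-- The normalized Lebesgue measure on the unit circle, which is parametrized by
`x ↦ AddCircle.toCircle x = exp (2 π i x)`, `x ∈ ℝ / ℤ`. -/
abbrev m : Measure UnitAddCircle := AddCircle.haarAddCircle

/-- The Lebesgue space `L²(𝕋)`. -/
abbrev L2 : Type := Lp ℂ 2 m

/-- The Lebesgue space `L^∞(𝕋)`. -/
abbrev Linf : Type := Lp ℂ ⊤ m

/-- The Hardy space `H²` as a subspace of `L²(𝕋)`: the functions all of whose Fourier
coefficients with negative index vanish. -/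
def H2 : Submodule ℂ L2 where
  carrier := {f | ∀ n : ℤ, n < 0 → fourierCoeff (f : UnitAddCircle → ℂ) n = 0}
  zero_mem' := by
    intro n _
    rw [← fourierBasis_repr]
    simp
  add_mem' := by
    intro f g hf hg n hn
    have h1 := hf n hn
    have h2 := hg n hn
    rw [← fourierBasis_repr] at h1 h2 ⊢
    simp [h1, h2]
  smul_mem' := by
    intro c f hf n hn
    have h1 := hf n hn
    rw [← fourierBasis_repr] at h1 ⊢
    simp [h1]

theorem isClosed_H2 : IsClosed (H2 : Set L2) := by
  have h : (H2 : Set L2) = ⋂ n : ℤ, ⋂ _ : n < 0, {f : L2 | fourierBasis.repr f n = 0} := by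
    ext f
    simp only [Set.mem_iInter, Set.mem_ofPred_eq, fourierBasis_repr]
    exact Iff.rfl
  rw [h]
  refine isClosed_iInter fun n => isClosed_iInter fun _ => ?_
  have h2 : (fun f : L2 => fourierBasis.repr f n)
      = fun f : L2 => inner ℂ (fourierBasis (T := 1) n) f := by
    funext f
    exact fourierBasis.repr_apply_apply f n
  refine isClosed_eq ?_ continuous_const
  rw [h2]
  fun_prop

instance : CompleteSpace H2 := isClosed_H2.completeSpace_coe

/-- The operator `M_a` of multiplication by `a ∈ L^∞(𝕋)` on `L²(𝕋)`. -/
def mulOp (a : Linf) : L2 →L[ℂ] L2 :=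
  (ContinuousLinearMap.mul ℂ ℂ).holderL m ⊤ 2 2 a

/-- The function `t ↦ t ^ n` on the unit circle, as an element of `L^∞(𝕋)`. -/
def monomial (n : ℤ) : Linf := fourierLp ⊤ n

/-- The operator `J` on `L²(𝕋)`, `(J f)(t) = t⁻¹ f(t⁻¹)`. -/
def flip : L2 →L[ℂ] L2 :=
  mulOp (monomial (-1)) ∘L
    (Lp.compMeasurePreservingₗᵢ ℂ (fun x : UnitAddCircle => -x)
      (Measure.measurePreserving_neg m)).toContinuousLinearMap

/-- The Hankel operator `H(a) = P M_a J` on `H²`. -/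
def hankel (a : Linf) : H2 →L[ℂ] H2 :=
  H2.orthogonalProjectionOnto ∘L mulOp a ∘L flip ∘L H2.subtypeL

/-- The operator `ι A P` on `L²(𝕋)` with which an operator `A` on `H²` is identified: it acts as
`A` on `H²` and is zero on the orthogonal complement of `H²`. -/
def extend (A : H2 →L[ℂ] H2) : L2 →L[ℂ] L2 :=
  H2.subtypeL ∘L A ∘L H2.orthogonalProjectionOnto

/-- The model space `K²_u = H² ⊖ u H²`. -/
def modelSpace (u : Linf) : Submodule ℂ L2 :=
  H2 ⊓ (H2.map (mulOp u : L2 →ₗ[ℂ] L2))ᗮ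

instance (u : Linf) : CompleteSpace (modelSpace u) :=
  (isClosed_H2.inter (Submodule.isClosed_orthogonal _)).completeSpace_coe

/-- The operator `R_u = P_u M_u J` on `L²(𝕋)`, where `P_u` is the orthogonal projection from
`L²(𝕋)` onto `K²_u`. -/
def R (u : Linf) : L2 →L[ℂ] L2 :=
  (modelSpace u).starProjection ∘L mulOp u ∘L flip

/-- The Stolz region in the unit disk with vertex `t ∈ 𝕋` and aperture `α`. -/
def stolz (t : ℂ) (α : ℝ) : Set ℂ :=
  {z | ‖z‖ < 1 ∧ ‖z - t‖ ≤ α * (1 - ‖z‖)}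

/-- `a` is the boundary function of the function `f` on the unit disk: at almost every point of
the circle, `f` has the non-tangential limit `a`. -/
def IsBoundaryFunction (f : ℂ → ℂ) (a : Linf) : Prop :=
  ∀ᵐ x ∂m, ∀ α : ℝ,
    Tendsto f (𝓝[stolz (AddCircle.toCircle x : ℂ) α] (AddCircle.toCircle x : ℂ)) (𝓝 (a x))

open Classical in
/-- The (essentially bounded, almost everywhere unique) boundary function of `f`; zero if there
is none. -/
def boundaryFunction (f : ℂ → ℂ) : Linf :=
  if h : ∃ a : Linf, IsBoundaryFunction f a then h.choose else 0

/-- The Blaschke factor `b_c` with zero `c`. -/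
def blaschkeFactor (c z : ℂ) : ℂ :=
  if c = 0 then z else (c - z) / (1 - star c * z) * ((‖c‖ : ℂ) / c)

/-- The Blaschke product with zeros `c 0, c 1, c 2, …`. -/
def blaschke (c : ℕ → ℂ) (z : ℂ) : ℂ := ∏' k, blaschkeFactor (c k) z

/-- The partial Blaschke product with the first `n` zeros of the sequence. -/
def partialBlaschke (c : ℕ → ℂ) (n : ℕ) (z : ℂ) : ℂ :=
  ∏ k ∈ Finset.range n, blaschkeFactor (c k) z

/-- `A n → B` `*`-strongly: `A n → B` strongly and `(A n)^* → B^*` strongly. -/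
def TendstoStarStrongly {E : Type*} [NormedAddCommGroup E] [InnerProductSpace ℂ E]
    [CompleteSpace E] (A : ℕ → E →L[ℂ] E) (B : E →L[ℂ] E) : Prop :=
  (∀ x, Tendsto (fun n => A n x) atTop (𝓝 (B x))) ∧
    ∀ x, Tendsto (fun n => ContinuousLinearMap.adjoint (A n) x) atTop
      (𝓝 (ContinuousLinearMap.adjoint B x))

/-- `A n → B` weakly. -/
def TendstoWeakly {E : Type*} [NormedAddCommGroup E] [InnerProductSpace ℂ E]
    (A : ℕ → E →L[ℂ] E) (B : E →L[ℂ] E) : Prop :=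
  ∀ x y, Tendsto (fun n => inner ℂ y (A n x)) atTop (𝓝 (inner ℂ y (B x)))

end

end HankelBlaschke

namespace HankelBlaschke

noncomputable section

/-! ### Multiplication operators -/

/-! For the identity `R u = H(u)`, only two facts about `u` matter: it is unimodular on the circle
and multiplication by it preserves H². Since `J` interchanges H² and its complement, `u J f` lies in
`u H²` for `f ⊥ H²`, hence is killed by the projection onto the model space. For `f ∈ H²`, `u J f`
is orthogonal to `u H²`, and there the projections onto H² and onto the model space agree
(`R_eq_extend_hankel`).

The convergence rests on L² convergence of the symbols. The mean value property gives `⟨u_n, u_p⟩ =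
∏_{n ≤ k < p} |λ_k|`, so `‖u_n - u_p‖² ≤ 2 ∑_{n ≤ k < p} (1 - |λ_k|)` and `(u_n)` is Cauchy. Its
limit `g` is bounded by 1, and the Poisson integral of `g` is the pointwise limit of `u_n(z)`,
namely the Blaschke product. Fatou's theorem, proved by a dyadic estimate of the Poisson kernel at
Lebesgue points, then identifies `g` as the non-tangential boundary function
(`exists_isBoundaryFunction_blaschke`).

L² convergence with a uniform sup bound gives strong convergence of the multiplication operators:
test on exponentials and use density. Multiplication operators are normal, so the adjoints converge
as well (`tendstoStarStrongly_hankel`). The weak limit of `H(t^n)` comes from the decay of Fourier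
coefficients. -/

theorem coeFn_mulOp (a : Linf) (f : L2) :
    (mulOp a f : UnitAddCircle → ℂ) =ᵐ[m] fun x => a x * f x := by
  exact ContinuousLinearMap.coeFn_holder (r := 2) (ContinuousLinearMap.mul ℂ ℂ) a f

theorem norm_mulOp_apply_le (a : Linf) (f : L2) : ‖mulOp a f‖ ≤ ‖a‖ * ‖f‖ := by
  have h := ContinuousLinearMap.norm_holder_apply_apply_le (r := 2)
    (ContinuousLinearMap.mul ℂ ℂ) a f
  have h1 : ‖ContinuousLinearMap.mul ℂ ℂ‖ ≤ 1 := ContinuousLinearMap.opNorm_mul_le ℂ ℂ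
  calc ‖mulOp a f‖ ≤ ‖ContinuousLinearMap.mul ℂ ℂ‖ * ‖a‖ * ‖f‖ := h
    _ ≤ 1 * ‖a‖ * ‖f‖ := by gcongr
    _ = ‖a‖ * ‖f‖ := by rw [one_mul]

theorem mulOp_sub (a b : Linf) : mulOp (a - b) = mulOp a - mulOp b :=
  map_sub ((ContinuousLinearMap.mul ℂ ℂ).holderL m ⊤ 2 2) a b

theorem adjoint_mulOp (a : Linf) : ContinuousLinearMap.adjoint (mulOp a) = mulOp (star a) := by
  symm
  rw [ContinuousLinearMap.eq_adjoint_iff]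
  intro f g
  rw [L2.inner_def, L2.inner_def]
  refine integral_congr_ae ?_
  filter_upwards [coeFn_mulOp (star a) f, coeFn_mulOp a g, Lp.coeFn_star a] with x h1 h2 h3
  rw [h1, h2, h3]
  simp
  ring

/-- Normality of multiplication operators, from `|ā| = |a|`; it turns strong convergence into
*-strong convergence. -/
theorem norm_adjoint_mulOp_apply (a : Linf) (f : L2) :
    ‖ContinuousLinearMap.adjoint (mulOp a) f‖ = ‖mulOp a f‖ := by
  rw [adjoint_mulOp, Lp.norm_def, Lp.norm_def]
  congr 1
  refine eLpNorm_congr_norm_ae ?_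
  filter_upwards [coeFn_mulOp (star a) f, coeFn_mulOp a f, Lp.coeFn_star a] with x h1 h2 h3
  rw [h1, h2, h3]
  simp

/-! ### Fourier coefficients -/

theorem inner_fourierLp (n : ℤ) (f : L2) :
    inner ℂ (fourierLp 2 n : L2) f = fourierCoeff (f : UnitAddCircle → ℂ) n := by
  rw [← fourierBasis_repr, fourierBasis.repr_apply_apply, coe_fourierBasis]

theorem inner_eq_zero_of_fourierCoeff {f g : L2}
    (h : ∀ n : ℤ, fourierCoeff (f : UnitAddCircle → ℂ) n = 0 ∨
      fourierCoeff (g : UnitAddCircle → ℂ) n = 0) : inner ℂ f g = 0 := by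
  rw [← fourierBasis.tsum_inner_mul_inner f g]
  convert tsum_zero with n
  rw [coe_fourierBasis, ← inner_conj_symm f, inner_fourierLp, inner_fourierLp]
  rcases h n with h | h <;> simp [h]

theorem fourierLp_mem_H2 {n : ℤ} (hn : 0 ≤ n) : (fourierLp 2 n : L2) ∈ H2 := by
  intro k hk
  rw [← inner_fourierLp]
  exact orthonormal_fourier.inner_eq_zero (by omega)

theorem mem_orthogonal_H2_iff {f : L2} :
    f ∈ H2ᗮ ↔ ∀ n : ℤ, 0 ≤ n → fourierCoeff (f : UnitAddCircle → ℂ) n = 0 := by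
  constructor
  · intro h n hn
    rw [← inner_fourierLp]
    exact (Submodule.mem_orthogonal _ _).1 h _ (fourierLp_mem_H2 hn)
  · intro h
    rw [Submodule.mem_orthogonal]
    intro g hg
    refine inner_eq_zero_of_fourierCoeff fun n => ?_
    rcases lt_or_ge n 0 with hn | hn
    · exact Or.inl (hg n hn)
    · exact Or.inr (h n hn)

theorem mulOp_monomial_fourierLp (n k : ℤ) :
    mulOp (monomial n) (fourierLp 2 k) = fourierLp 2 (n + k) := by
  apply Lp.ext
  filter_upwards [coeFn_mulOp (monomial n) (fourierLp 2 k), coeFn_fourierLp (T := 1) ⊤ n,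
    coeFn_fourierLp (T := 1) 2 k, coeFn_fourierLp (T := 1) 2 (n + k)] with x h1 h2 h3 h4
  rw [h1, h3, h4, fourier_add, monomial, h2]

/-- Substituting `x ↦ -x` reflects the frequencies about `-1/2`. This exchanges `n < 0` with `n ≥
0`, so `J` swaps H² and its complement. -/
theorem fourierCoeff_flip (f : L2) (n : ℤ) :
    fourierCoeff (flip f : UnitAddCircle → ℂ) n
      = fourierCoeff (f : UnitAddCircle → ℂ) (-1 - n) := by
  have h : (flip f : UnitAddCircle → ℂ) =ᵐ[m] fun x => fourier (-1) x * f (-x) := by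
    filter_upwards [coeFn_mulOp (monomial (-1)) (Lp.compMeasurePreserving
      (fun x : UnitAddCircle => -x) (Measure.measurePreserving_neg m) f),
      coeFn_fourierLp (T := 1) ⊤ (-1),
      Lp.coeFn_compMeasurePreserving f (Measure.measurePreserving_neg m)] with x h1 h2 h3
    have h4 : (flip f : UnitAddCircle → ℂ) x = _ := h1
    rw [h4, h3, monomial, h2]
    rfl
  rw [fourierCoeff_congr_ae h]
  simp only [fourierCoeff]
  rw [← integral_neg_eq_self]
  refine integral_congr_ae (Eventually.of_forall fun x => ?_)
  have : fourier (-(-1 - n)) x = fourier (-n) (-x) * fourier (-1) (-x) := by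
    rw [← fourier_add]
    simp only [fourier_apply]
    congr 2
    rw [smul_neg, ← neg_smul]
    congr 1
    ring
  simp only [this, smul_eq_mul, neg_neg]
  ring

theorem flip_mem_orthogonal {f : L2} (hf : f ∈ H2) : flip f ∈ H2ᗮ := by
  rw [mem_orthogonal_H2_iff]
  intro n hn
  rw [fourierCoeff_flip]
  exact hf _ (by omega)

theorem flip_mem_H2 {f : L2} (hf : f ∈ H2ᗮ) : flip f ∈ H2 := by
  intro n hn
  rw [fourierCoeff_flip]
  exact mem_orthogonal_H2_iff.1 hf _ (by omega)

/-! ### The operators `R u` and `H(u)` for inner functions `u` -/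

/-- The Fourier series of `f` has only nonnegative frequencies, and H² is closed, so exponentials
suffice. -/
theorem mulOp_mem_H2 {u : Linf}
    (hu : ∀ k : ℤ, 0 ≤ k → mulOp u (fourierLp 2 k) ∈ H2) {f : L2} (hf : f ∈ H2) :
    mulOp u f ∈ H2 := by
  have h := (mulOp u).hasSum (fourierBasis.hasSum_repr f)
  refine isClosed_H2.mem_of_tendsto h (Eventually.of_forall fun s => ?_)
  refine Submodule.sum_mem _ fun k _ => ?_
  rw [map_smul, coe_fourierBasis]
  rcases lt_or_ge k 0 with hk | hk
  · rw [fourierBasis_repr, hf k hk, zero_smul]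
    exact Submodule.zero_mem _
  · exact Submodule.smul_mem _ _ (hu k hk)

theorem inner_mulOp_mulOp {u : Linf} (hu : ∀ᵐ x ∂m, ‖u x‖ = 1) (f g : L2) :
    inner ℂ (mulOp u f) (mulOp u g) = inner ℂ f g := by
  rw [L2.inner_def, L2.inner_def]
  refine integral_congr_ae ?_
  filter_upwards [coeFn_mulOp u f, coeFn_mulOp u g, hu] with x h1 h2 h3
  rw [h1, h2]
  have : u x * (starRingEnd ℂ) (u x) = 1 := by
    rw [Complex.mul_conj, Complex.normSq_eq_norm_sq, h3]
    simp
  simp only [RCLike.inner_apply, map_mul]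
  linear_combination (g x * (starRingEnd ℂ) (f x)) * this

theorem R_eq_extend_hankel {u : Linf} (hu : ∀ᵐ x ∂m, ‖u x‖ = 1)
    (hH : ∀ f ∈ H2, mulOp u f ∈ H2) : R u = extend (hankel u) := by
  have hle : H2.map (mulOp u : L2 →ₗ[ℂ] L2) ≤ H2 := by
    rintro _ ⟨f, hf, rfl⟩
    exact hH f hf
  have h0 : ∀ f ∈ H2ᗮ, R u f = 0 := by
    intro f hf
    refine Submodule.starProjection_apply_eq_zero_iff _ |>.2 ?_
    rw [Submodule.mem_orthogonal]
    intro g hg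
    rw [← inner_conj_symm]
    have hg2 := (Submodule.mem_inf.1 hg).2
    have : inner ℂ (mulOp u (flip f)) g = 0 :=
      (Submodule.mem_orthogonal _ _).1 hg2 (mulOp u (flip f)) ⟨flip f, flip_mem_H2 hf, rfl⟩
    change (starRingEnd ℂ) (inner ℂ (mulOp u (flip f)) g) = 0
    rw [this, map_zero]
  have h1 : ∀ f ∈ H2, R u f = H2.starProjection (mulOp u (flip f)) := by
    intro f hf
    set g := mulOp u (flip f) with hg
    have hort : g ∈ (H2.map (mulOp u : L2 →ₗ[ℂ] L2))ᗮ := by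
      rw [Submodule.mem_orthogonal]
      rintro _ ⟨k, hk, rfl⟩
      change inner ℂ (mulOp u k) (mulOp u (flip f)) = 0
      rw [inner_mulOp_mulOp hu]
      exact (Submodule.mem_orthogonal _ _).1 (flip_mem_orthogonal hf) k hk
    change (modelSpace u).starProjection g = _
    -- The part of `g` removed by projecting to H² is orthogonal to H², hence to `u H²`; so the
    -- projected vector stays orthogonal to `u H²` and already lies in the model space.
    have hrest : g - H2.starProjection g ∈ H2ᗮ := H2.sub_starProjection_mem_orthogonal g
    refine Submodule.eq_starProjection_of_mem_of_inner_eq_zero ?_ ?_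
    · refine Submodule.mem_inf.2 ⟨Submodule.starProjection_apply_mem _ _, ?_⟩
      have := Submodule.sub_mem _ hort (Submodule.orthogonal_le hle hrest)
      simpa using this
    · intro w hw
      exact Submodule.inner_left_of_mem_orthogonal (Submodule.mem_inf.1 hw).1 hrest
  ext1 f
  have hdec : f = H2.starProjection f + (f - H2.starProjection f) := by abel
  have e1 : R u f = H2.starProjection (mulOp u (flip (H2.starProjection f))) := by
    conv_lhs => rw [hdec]
    rw [map_add, h0 _ (H2.sub_starProjection_mem_orthogonal f), add_zero,
      h1 _ (Submodule.starProjection_apply_mem _ _)]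
  rw [e1]
  rfl

/-! ### Strong and weak convergence -/

theorem tendsto_zero_of_tendsto_fourierLp {F : Type*} [NormedAddCommGroup F] [NormedSpace ℂ F]
    {D : ℕ → L2 →L[ℂ] F} {C : ℝ} (hC : ∀ n f, ‖D n f‖ ≤ C * ‖f‖)
    (h : ∀ k : ℤ, Tendsto (fun n => D n (fourierLp 2 k)) atTop (𝓝 0)) (f : L2) :
    Tendsto (fun n => D n f) atTop (𝓝 0) := by
  let S : Submodule ℂ L2 :=
    { carrier := {g | Tendsto (fun n => D n g) atTop (𝓝 0)}
      zero_mem' := by simp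
      add_mem' := by
        intro a b ha hb
        simpa using Tendsto.add ha hb
      smul_mem' := by
        intro c a ha
        simpa using Tendsto.const_smul ha c }
  have hS : IsClosed (S : Set L2) := by
    refine isClosed_of_closure_subset fun g hg => ?_
    change Tendsto (fun n => D n g) atTop (𝓝 0)
    rw [Metric.tendsto_atTop]
    intro ε hε
    -- `C` may be zero and has no assumed sign; `|C| + 1` is a positive bound to divide by.
    have hC0 : 0 < |C| + 1 := by positivity
    obtain ⟨g', hg', hd⟩ := Metric.mem_closure_iff.1 hg (ε / 2 / (|C| + 1)) (by positivity)
    obtain ⟨N, hN⟩ := Metric.tendsto_atTop.1 (show Tendsto (fun n => D n g') atTop (𝓝 0) from hg')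
      (ε / 2) (by positivity)
    refine ⟨N, fun n hn => ?_⟩
    have h1 := hN n hn
    rw [dist_zero_right] at h1 ⊢
    rw [dist_eq_norm] at hd
    have h2 : ‖D n (g - g')‖ < ε / 2 := by
      calc ‖D n (g - g')‖ ≤ C * ‖g - g'‖ := hC n _
        _ ≤ (|C| + 1) * ‖g - g'‖ := by
          gcongr
          linarith [le_abs_self C]
        _ < (|C| + 1) * (ε / 2 / (|C| + 1)) := by gcongr
        _ = ε / 2 := by field_simp
    calc ‖D n g‖ = ‖D n (g - g') + D n g'‖ := by rw [← map_add, sub_add_cancel]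
      _ ≤ ‖D n (g - g')‖ + ‖D n g'‖ := norm_add_le _ _
      _ < ε := by linarith
  have hspan : Submodule.span ℂ (Set.range (fourierLp (T := 1) 2)) ≤ S := by
    rw [Submodule.span_le]
    rintro _ ⟨k, rfl⟩
    exact h k
  have hle := Submodule.topologicalClosure_minimal _ hspan hS
  rw [span_fourierLp_closure_eq_top (by simp)] at hle
  exact hle Submodule.mem_top

/-- On an exponential `f` the pairing is, up to conjugation, a Fourier coefficient of `y` whose
index goes to infinity, so Bessel's inequality applies; density does the rest. -/
theorem tendsto_inner_mulOp_monomial (y f : L2) :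
    Tendsto (fun n : ℕ => inner ℂ y (mulOp (monomial (n : ℤ)) f)) atTop (𝓝 0) := by
  have hmon : ∀ n : ℤ, ‖monomial n‖ ≤ 1 := by
    intro n
    refine Lp.norm_le_of_ae_bound (μ := m) (p := ⊤) (C := 1) (by norm_num) ?_ |>.trans (by simp)
    filter_upwards [coeFn_fourierLp (T := 1) ⊤ n] with x hx
    rw [monomial, hx, fourier_apply, Circle.norm_coe]
  refine tendsto_zero_of_tendsto_fourierLp (C := ‖y‖)
    (D := fun n : ℕ => innerSL ℂ y ∘L mulOp (monomial (n : ℤ))) ?_ ?_ f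
  · intro n g
    calc ‖inner ℂ y (mulOp (monomial n) g)‖ ≤ ‖y‖ * ‖mulOp (monomial n) g‖ := norm_inner_le_norm _ _
      _ ≤ ‖y‖ * (1 * ‖g‖) := by
        gcongr
        exact (norm_mulOp_apply_le _ _).trans (by gcongr; exact hmon _)
      _ = ‖y‖ * ‖g‖ := by rw [one_mul]
  · intro k
    have hsum : Summable fun i : ℤ => ‖inner ℂ (fourierLp 2 i : L2) y‖ ^ 2 :=
      orthonormal_fourier.inner_products_summable y
    have hz := hsum.tendsto_cofinite_zero
    have hz2 : Tendsto (fun i : ℤ => ‖inner ℂ (fourierLp 2 i : L2) y‖) cofinite (𝓝 0) := by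
      have := hz.sqrt
      simpa using this
    have hinj : Tendsto (fun n : ℕ => (n : ℤ) + k) atTop cofinite := by
      rw [← Nat.cofinite_eq_atTop]
      exact Function.Injective.tendsto_cofinite fun a b hab => by simpa using hab
    rw [tendsto_zero_iff_norm_tendsto_zero]
    refine (hz2.comp hinj).congr fun n => ?_
    simp only [Function.comp_apply, ContinuousLinearMap.comp_apply, innerSL_apply_apply]
    rw [mulOp_monomial_fourierLp, norm_inner_symm]

theorem tendstoWeakly_hankel_monomial :
    TendstoWeakly (fun n : ℕ => hankel (monomial (n : ℤ))) 0 := by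
  intro x y
  have h := tendsto_inner_mulOp_monomial (y : L2) (flip x)
  simp only [zero_apply, inner_zero_right]
  refine h.congr fun n => ?_
  exact (Submodule.inner_orthogonalProjectionOnto_eq_of_mem_left y _).symm

/-- If the symbols are uniformly bounded and converge in `L²`, then the multiplication operators
converge strongly. -/
theorem tendsto_mulOp_sub_apply {a : ℕ → Linf} {b : Linf} {C : ℝ} (hC : ∀ n, ‖a n‖ ≤ C)
    (h : Tendsto (fun n => eLpNorm (a n - b) 2 m) atTop (𝓝 0)) (f : L2) :
    Tendsto (fun n => mulOp (a n - b) f) atTop (𝓝 0) := by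
  refine tendsto_zero_of_tendsto_fourierLp (C := C + ‖b‖) (D := fun n => mulOp (a n - b)) ?_ ?_ f
  · intro n g
    refine (norm_mulOp_apply_le _ _).trans ?_
    gcongr
    exact (norm_sub_le _ _).trans (by gcongr; exact hC n)
  · intro k
    rw [tendsto_zero_iff_norm_tendsto_zero]
    have h1 := (ENNReal.tendsto_toReal ENNReal.zero_ne_top).comp h
    rw [ENNReal.toReal_zero] at h1
    refine h1.congr fun n => ?_
    rw [Lp.norm_def]
    simp only [Function.comp_apply]
    congr 1
    refine eLpNorm_congr_norm_ae ?_
    filter_upwards [coeFn_mulOp (a n - b) (fourierLp 2 k), coeFn_fourierLp (T := 1) 2 k] with x h1 h2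
    rw [h1, h2, fourier_apply, norm_mul, Circle.norm_coe, mul_one]

theorem tendstoStarStrongly_hankel {a : ℕ → Linf} {b : Linf} {C : ℝ} (hC : ∀ n, ‖a n‖ ≤ C)
    (h : Tendsto (fun n => eLpNorm (a n - b) 2 m) atTop (𝓝 0)) :
    TendstoStarStrongly (fun n => hankel (a n)) (hankel b) := by
  constructor
  · intro x
    rw [tendsto_iff_norm_sub_tendsto_zero]
    have h1 := tendsto_mulOp_sub_apply hC h (flip x)
    rw [tendsto_zero_iff_norm_tendsto_zero] at h1
    refine squeeze_zero (fun _ => norm_nonneg _) (fun n => ?_) h1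
    rw [mulOp_sub]
    have : hankel (a n) x - hankel b x
        = H2.orthogonalProjectionOnto ((mulOp (a n) - mulOp b) (flip x)) := by
      simp [hankel]
    rw [this]
    exact Submodule.norm_orthogonalProjectionOnto_apply_le _ _
  · intro x
    rw [tendsto_iff_norm_sub_tendsto_zero]
    have h1 := tendsto_mulOp_sub_apply hC h x
    rw [tendsto_zero_iff_norm_tendsto_zero] at h1
    have h2 := h1.const_mul ‖ContinuousLinearMap.adjoint (flip ∘L H2.subtypeL)‖
    rw [mul_zero] at h2
    refine squeeze_zero (fun _ => norm_nonneg _) (fun n => ?_) h2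
    have hadj : ∀ u : Linf, ContinuousLinearMap.adjoint (hankel u) x
        = ContinuousLinearMap.adjoint (flip ∘L H2.subtypeL)
          (ContinuousLinearMap.adjoint (mulOp u) x) := by
      intro u
      rw [hankel, ContinuousLinearMap.adjoint_comp, ContinuousLinearMap.adjoint_comp,
        Submodule.adjoint_orthogonalProjectionOnto]
      rfl
    have hsub : ContinuousLinearMap.adjoint (mulOp (a n)) (x : L2)
        - ContinuousLinearMap.adjoint (mulOp b) (x : L2)
        = ContinuousLinearMap.adjoint (mulOp (a n - b)) (x : L2) := by
      rw [mulOp_sub, map_sub, sub_apply]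
    rw [hadj, hadj, ← map_sub, hsub, ← norm_adjoint_mulOp_apply (a n - b) x]
    exact (ContinuousLinearMap.adjoint (flip ∘L H2.subtypeL)).le_opNorm _

theorem TendstoStarStrongly.extend {A : ℕ → H2 →L[ℂ] H2} {B : H2 →L[ℂ] H2}
    (h : TendstoStarStrongly A B) :
    TendstoStarStrongly (fun n => extend (A n)) (HankelBlaschke.extend B) := by
  have hadj : ∀ A : H2 →L[ℂ] H2, ContinuousLinearMap.adjoint (HankelBlaschke.extend A)
      = HankelBlaschke.extend (ContinuousLinearMap.adjoint A) := by
    intro A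
    rw [HankelBlaschke.extend, ContinuousLinearMap.adjoint_comp, ContinuousLinearMap.adjoint_comp,
      Submodule.adjoint_orthogonalProjectionOnto, Submodule.adjoint_subtypeL]
    rfl
  constructor
  · intro x
    exact (H2.subtypeL.continuous.tendsto _).comp (h.1 (H2.orthogonalProjectionOnto x))
  · intro x
    simp only [hadj]
    exact (H2.subtypeL.continuous.tendsto _).comp (h.2 (H2.orthogonalProjectionOnto x))

/-! ### Integrals over the circle -/

theorem integral_toCircle (F : ℂ → ℂ) :
    ∫ x, F (AddCircle.toCircle x : ℂ) ∂m = Real.circleAverage F 0 1 := by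
  rw [AddCircle.integral_haarAddCircle, inv_one, one_smul,
    ← UnitAddCircle.intervalIntegral_preimage 0, Real.circleAverage_def]
  have h : ∀ a : ℝ, F (AddCircle.toCircle (a : UnitAddCircle) : ℂ)
      = (fun θ => F (circleMap 0 1 θ)) (2 * Real.pi * a) := by
    intro a
    simp [AddCircle.toCircle_apply_mk, circleMap, Circle.coe_exp]
  simp only [h]
  rw [intervalIntegral.integral_comp_mul_left (fun θ => F (circleMap 0 1 θ))
    (c := 2 * Real.pi) (by positivity)]
  simp

theorem coe_toCircle_zsmul (n : ℤ) (x : UnitAddCircle) :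
    (AddCircle.toCircle (n • x) : ℂ) = (AddCircle.toCircle x : ℂ) ^ n := by
  rw [AddCircle.toCircle_zsmul, Circle.coe_zpow]

theorem integral_toCircle_of_diffContOnCl {F : ℂ → ℂ}
    (hF : DiffContOnCl ℂ F (Metric.ball 0 1)) :
    ∫ x, F (AddCircle.toCircle x : ℂ) ∂m = F 0 := by
  rw [integral_toCircle]
  have := DiffContOnCl.circleAverage (f := F) (c := 0) (R := 1) (by simpa using hF)
  exact this

/-- The Poisson kernel `s ↦ P_z(s)` with pole `z` in the unit disk. -/
def poisson (z : ℂ) (x : UnitAddCircle) : ℝ := poissonKernel 0 z (AddCircle.toCircle x : ℂ)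

theorem poisson_eq (z : ℂ) (x : UnitAddCircle) :
    poisson z x = (1 - ‖z‖ ^ 2) / ‖(AddCircle.toCircle x : ℂ) - z‖ ^ 2 := by
  simp only [poisson, poissonKernel_def, sub_zero, Circle.norm_coe, one_pow]

theorem integral_poisson_smul {F : ℂ → ℂ} (hF : DiffContOnCl ℂ F (Metric.ball 0 1)) {z : ℂ}
    (hz : ‖z‖ < 1) : ∫ x, (poisson z x : ℂ) * F (AddCircle.toCircle x : ℂ) ∂m = F z := by
  have h := integral_toCircle fun w => (poissonKernel 0 z w : ℂ) * F w
  simp only [poisson]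
  rw [h, ← hF.circleAverage_poissonKernel_smul (w := z) (by simpa using hz)]
  congr 1

theorem one_sub_norm_le_norm_toCircle_sub (z : ℂ) (x : UnitAddCircle) :
    1 - ‖z‖ ≤ ‖(AddCircle.toCircle x : ℂ) - z‖ := by
  have h := norm_sub_norm_le (AddCircle.toCircle x : ℂ) z
  rwa [Circle.norm_coe] at h

theorem continuous_poisson {z : ℂ} (hz : ‖z‖ < 1) : Continuous (poisson z) := by
  have h : poisson z = fun x => (1 - ‖z‖ ^ 2) / ‖(AddCircle.toCircle x : ℂ) - z‖ ^ 2 :=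
    funext (poisson_eq z)
  rw [h]
  have hc : Continuous fun x : UnitAddCircle => (AddCircle.toCircle x : ℂ) :=
    continuous_subtype_val.comp AddCircle.continuous_toCircle
  refine Continuous.div continuous_const (by fun_prop) fun x => ?_
  have := one_sub_norm_le_norm_toCircle_sub z x
  have h2 : 0 < ‖(AddCircle.toCircle x : ℂ) - z‖ := by linarith
  positivity

theorem poisson_nonneg {z : ℂ} (hz : ‖z‖ < 1) (x : UnitAddCircle) : 0 ≤ poisson z x := by
  rw [poisson_eq]
  have : ‖z‖ ^ 2 ≤ 1 := pow_le_one₀ (norm_nonneg z) hz.le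
  exact div_nonneg (by linarith) (by positivity)

/-! ### Blaschke factors -/

theorem one_sub_star_mul_ne_zero {c z : ℂ} (hc : ‖c‖ < 1) (hz : ‖z‖ ≤ 1) :
    1 - star c * z ≠ 0 := by
  intro h
  have h1 : ‖star c * z‖ = 1 := by rw [← sub_eq_zero.1 h, norm_one]
  rw [norm_mul, norm_star] at h1
  nlinarith [norm_nonneg c, norm_nonneg z]

theorem differentiableAt_blaschkeFactor {c z : ℂ} (hc : ‖c‖ < 1) (hz : ‖z‖ ≤ 1) :
    DifferentiableAt ℂ (blaschkeFactor c) z := by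
  by_cases h : c = 0
  · have : blaschkeFactor c = fun z => z := by
      funext w
      simp [blaschkeFactor, h]
    rw [this]
    exact differentiableAt_id
  · have : blaschkeFactor c = fun z => (c - z) / (1 - star c * z) * ((‖c‖ : ℂ) / c) := by
      funext w
      simp [blaschkeFactor, h]
    rw [this]
    have := one_sub_star_mul_ne_zero hc hz
    fun_prop (disch := assumption)

theorem norm_blaschkeFactor {c z : ℂ} (hc : ‖c‖ < 1) (hz : ‖z‖ = 1) :
    ‖blaschkeFactor c z‖ = 1 := by
  by_cases h : c = 0
  · simp [blaschkeFactor, h, hz]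
  · have h1 := one_sub_star_mul_ne_zero hc hz.le
    have hz1 : z * (starRingEnd ℂ) z = 1 := by
      rw [Complex.mul_conj, Complex.normSq_eq_norm_sq, hz]
      simp
    have h2 : ‖c - z‖ = ‖1 - star c * z‖ := by
      -- On the circle `z z̄ = 1`, so numerator and conjugated denominator differ by a unimodular
      -- factor.
      have h3 : c - z = -(z * (starRingEnd ℂ) (1 - star c * z)) := by
        simp only [map_sub, map_mul, map_one, Complex.star_def, Complex.conj_conj]
        linear_combination (-c) * hz1
      rw [h3, norm_neg, norm_mul, hz, one_mul, RCLike.norm_conj]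
    have h4 : ‖c‖ ≠ 0 := norm_ne_zero_iff.2 h
    simp only [blaschkeFactor, h, if_false, norm_mul, norm_div, Complex.norm_real, norm_norm]
    rw [h2, div_self (norm_ne_zero_iff.2 h1), div_self h4, one_mul]

theorem blaschkeFactor_zero_right (c : ℂ) : blaschkeFactor c 0 = ‖c‖ := by
  by_cases h : c = 0
  · simp [blaschkeFactor, h]
  · simp only [blaschkeFactor, h, if_false]
    field_simp
    simp

/-- The factor `1 - |c|` splits off `b_c(z) - 1` exactly, thanks to the normalization `|c|/c`; the
Blaschke condition thus gives absolute convergence of the product. -/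
theorem norm_blaschkeFactor_sub_one_le {c z : ℂ} (hc : ‖c‖ < 1) (hz : ‖z‖ < 1) :
    ‖blaschkeFactor c z - 1‖ ≤ 2 / (1 - ‖z‖) * (1 - ‖c‖) := by
  have hz' : 0 < 1 - ‖z‖ := by linarith
  by_cases h : c = 0
  · simp only [blaschkeFactor, h, if_true, norm_zero, sub_zero, mul_one]
    have h1 : ‖z - 1‖ ≤ 2 := by
      have := norm_sub_le z 1
      rw [norm_one] at this
      linarith
    have h2 : 2 ≤ 2 / (1 - ‖z‖) := by
      rw [le_div_iff₀ hz']
      linarith [norm_nonneg z]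
    linarith
  · have h1 := one_sub_star_mul_ne_zero hc hz.le
    have hcc : star c * c = (‖c‖ : ℂ) ^ 2 := by
      rw [Complex.star_def, mul_comm, Complex.mul_conj, Complex.normSq_eq_norm_sq]
      simp
    have h2 : blaschkeFactor c z - 1
        = -((1 - ‖c‖ : ℂ) * (c + z * ‖c‖) / (c * (1 - star c * z))) := by
      simp only [blaschkeFactor, h, if_false]
      rw [div_mul_div_comm, mul_comm (1 - star c * z) c, div_sub_one (mul_ne_zero h h1), ← neg_div]
      congr 1
      linear_combination z * hcc
    have hc0 : 0 < ‖c‖ := norm_pos_iff.2 h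
    have h3 : ‖(1 - ‖c‖ : ℂ)‖ = 1 - ‖c‖ := by
      rw [← Complex.ofReal_one, ← Complex.ofReal_sub, Complex.norm_real, Real.norm_eq_abs,
        abs_of_pos (by linarith)]
    have h4 : ‖c + z * ‖c‖‖ ≤ 2 * ‖c‖ := by
      refine (norm_add_le _ _).trans ?_
      rw [norm_mul, Complex.norm_real, norm_norm]
      nlinarith
    have h5 : 1 - ‖z‖ ≤ ‖1 - star c * z‖ := by
      have := norm_sub_norm_le 1 (star c * z)
      rw [norm_one, norm_mul, norm_star] at this
      nlinarith [norm_nonneg z]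
    rw [h2, norm_neg, norm_div, norm_mul, norm_mul, h3]
    calc (1 - ‖c‖) * ‖c + z * ‖c‖‖ / (‖c‖ * ‖1 - star c * z‖)
        ≤ (1 - ‖c‖) * (2 * ‖c‖) / (‖c‖ * (1 - ‖z‖)) := by
          have : 0 ≤ 1 - ‖c‖ := by linarith
          gcongr
      _ = 2 / (1 - ‖z‖) * (1 - ‖c‖) := by field_simp

/-! ### Blaschke products -/

theorem hasProd_blaschke {c : ℕ → ℂ} (hc : ∀ k, ‖c k‖ < 1) (hs : Summable fun k => 1 - ‖c k‖)
    {z : ℂ} (hz : ‖z‖ < 1) : HasProd (fun k => blaschkeFactor (c k) z) (blaschke c z) := by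
  have h : Summable fun k => ‖blaschkeFactor (c k) z - 1‖ :=
    Summable.of_nonneg_of_le (fun _ => norm_nonneg _)
      (fun k => norm_blaschkeFactor_sub_one_le (hc k) hz) (hs.mul_left _)
  have h2 := multipliable_one_add_of_summable h
  simp only [add_sub_cancel] at h2
  exact h2.hasProd

theorem differentiableAt_partialBlaschke {c : ℕ → ℂ} (hc : ∀ k, ‖c k‖ < 1) (n : ℕ) {z : ℂ}
    (hz : ‖z‖ ≤ 1) : DifferentiableAt ℂ (partialBlaschke c n) z := by
  have : partialBlaschke c n = fun z => ∏ k ∈ Finset.range n, blaschkeFactor (c k) z := rfl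
  rw [this]
  exact DifferentiableAt.fun_finsetProd fun k _ => differentiableAt_blaschkeFactor (hc k) hz

theorem diffContOnCl_of_differentiableAt {F : ℂ → ℂ}
    (h : ∀ z, ‖z‖ ≤ 1 → DifferentiableAt ℂ F z) : DiffContOnCl ℂ F (Metric.ball 0 1) := by
  refine DifferentiableOn.diffContOnCl fun z hz => (h z ?_).differentiableWithinAt
  rw [closure_ball _ one_ne_zero] at hz
  simpa using hz

theorem norm_partialBlaschke {c : ℕ → ℂ} (hc : ∀ k, ‖c k‖ < 1) (n : ℕ) {z : ℂ}
    (hz : ‖z‖ = 1) : ‖partialBlaschke c n z‖ = 1 := by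
  rw [partialBlaschke, norm_prod]
  exact Finset.prod_eq_one fun k _ => norm_blaschkeFactor (hc k) hz

/-! ### Boundary functions -/

/-- The Stolz region of aperture 1 contains the radius ending at `t`, so the limit is taken along a
nontrivial filter and is unique. -/
theorem IsBoundaryFunction.eq {f : ℂ → ℂ} {a b : Linf} (ha : IsBoundaryFunction f a)
    (hb : IsBoundaryFunction f b) : a = b := by
  apply Lp.ext
  filter_upwards [ha, hb] with x h1 h2
  set t : ℂ := (AddCircle.toCircle x : ℂ) with ht
  have hnorm : ‖t‖ = 1 := Circle.norm_coe _
  have hne : (𝓝[stolz t 1] t).NeBot := by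
    rw [← mem_closure_iff_nhdsWithin_neBot, Metric.mem_closure_iff]
    intro ε hε
    set r : ℝ := max (1 - ε / 2) 0 with hr
    have hr0 : 0 ≤ r := le_max_right _ _
    have hr1 : r < 1 := max_lt (by linarith) one_pos
    have hr2 : 1 - r ≤ ε / 2 := by linarith [le_max_left (1 - ε / 2) 0]
    have hrt : ‖(r : ℂ) * t‖ = r := by
      rw [norm_mul, hnorm, Complex.norm_real, Real.norm_of_nonneg hr0, mul_one]
    have hd : ‖(r : ℂ) * t - t‖ = 1 - r := by
      have : (r : ℂ) * t - t = -(((1 - r : ℝ) : ℂ) * t) := by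
        push_cast
        ring
      rw [this, norm_neg, norm_mul, hnorm, Complex.norm_real, Real.norm_of_nonneg (by linarith),
        mul_one]
    refine ⟨r * t, ⟨by rw [hrt]; exact hr1, by rw [hd, hrt, one_mul]⟩, ?_⟩
    rw [dist_comm, dist_eq_norm, hd]
    linarith
  exact tendsto_nhds_unique (h1 1) (h2 1)

theorem boundaryFunction_eq {f : ℂ → ℂ} {a : Linf} (ha : IsBoundaryFunction f a) :
    boundaryFunction f = a := by
  have h : ∃ a : Linf, IsBoundaryFunction f a := ⟨a, ha⟩
  rw [boundaryFunction, dif_pos h]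
  exact h.choose_spec.eq ha

/-- The partial Blaschke product as a continuous function on the circle. -/
def partialBlaschkeCircle {c : ℕ → ℂ} (hc : ∀ k, ‖c k‖ < 1) (n : ℕ) : C(UnitAddCircle, ℂ) where
  toFun x := partialBlaschke c n (AddCircle.toCircle x : ℂ)
  continuous_toFun := by
    rw [continuous_iff_continuousAt]
    intro x
    refine ContinuousAt.comp (g := partialBlaschke c n)
      (differentiableAt_partialBlaschke hc n (Circle.norm_coe _).le).continuousAt ?_
    exact (continuous_subtype_val.comp AddCircle.continuous_toCircle).continuousAt

theorem isBoundaryFunction_partialBlaschke {c : ℕ → ℂ} (hc : ∀ k, ‖c k‖ < 1) (n : ℕ) :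
    IsBoundaryFunction (partialBlaschke c n)
      (ContinuousMap.toLp ⊤ m ℂ (partialBlaschkeCircle hc n)) := by
  filter_upwards [ContinuousMap.coeFn_toLp (p := ⊤) (𝕜 := ℂ) m (partialBlaschkeCircle hc n)]
    with x hx α
  rw [hx]
  exact (differentiableAt_partialBlaschke hc n (Circle.norm_coe _).le).continuousAt.mono_left
    nhdsWithin_le_nhds

theorem mulOp_partialBlaschke_fourierLp_mem_H2 {c : ℕ → ℂ} (hc : ∀ k, ‖c k‖ < 1) (n : ℕ)
    {k : ℤ} (hk : 0 ≤ k) :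
    mulOp (ContinuousMap.toLp ⊤ m ℂ (partialBlaschkeCircle hc n)) (fourierLp 2 k) ∈ H2 := by
  intro j hj
  have hae : (mulOp (ContinuousMap.toLp ⊤ m ℂ (partialBlaschkeCircle hc n)) (fourierLp 2 k) :
      UnitAddCircle → ℂ) =ᵐ[m] fun x => partialBlaschke c n (AddCircle.toCircle x : ℂ)
        * fourier k x := by
    filter_upwards [ContinuousMap.coeFn_toLp (p := ⊤) (𝕜 := ℂ) m (partialBlaschkeCircle hc n),
      coeFn_mulOp (ContinuousMap.toLp ⊤ m ℂ (partialBlaschkeCircle hc n)) (fourierLp 2 k),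
      coeFn_fourierLp (T := 1) 2 k] with x h1 h2 h3
    rw [h2, h1, h3]
    rfl
  rw [fourierCoeff_congr_ae hae]
  -- As `j < 0 ≤ k`, the exponent `k - j` is at least 1; the coefficient is the value at 0 of `z ^
  -- (p + 1) u_n(z)`, which vanishes.
  obtain ⟨p, hp⟩ : ∃ p : ℕ, k - j = (p : ℤ) + 1 := ⟨(k - j - 1).toNat, by omega⟩
  have hF : DiffContOnCl ℂ (fun z => z ^ (p + 1) * partialBlaschke c n z) (Metric.ball 0 1) := by
    refine diffContOnCl_of_differentiableAt fun z hz => ?_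
    have := differentiableAt_partialBlaschke hc n hz
    fun_prop
  have h := integral_toCircle_of_diffContOnCl hF
  simp only [ne_eq, Nat.add_eq_zero_iff, one_ne_zero, and_false, not_false_eq_true, zero_pow,
    zero_mul] at h
  rw [fourierCoeff, ← h]
  refine integral_congr_ae (Eventually.of_forall fun x => ?_)
  have e : fourier (-j) x * fourier k x = (AddCircle.toCircle x : ℂ) ^ (p + 1) := by
    rw [← fourier_add, fourier_apply, coe_toCircle_zsmul, show -j + k = ((p + 1 : ℕ) : ℤ) by
      push_cast; omega, zpow_natCast]
  simp only [smul_eq_mul]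
  rw [← e]
  ring

/-! ### Non-tangential limits of Poisson integrals -/

/-- After rotation to `x = 0`, the chord is `2 |sin πr|` with `|r| ≤ 1/2`, and Jordan's inequality
bounds it below by `4 |r|`. -/
theorem norm_sub_le_norm_toCircle_sub (s x : UnitAddCircle) :
    ‖s - x‖ ≤ ‖(AddCircle.toCircle s : ℂ) - AddCircle.toCircle x‖ := by
  have key : ∀ y : UnitAddCircle, ‖y‖ ≤ ‖(AddCircle.toCircle y : ℂ) - 1‖ := by
    intro y
    obtain ⟨r, hr, hry⟩ : ∃ r : ℝ, |r| ≤ 1 / 2 ∧ (r : UnitAddCircle) = y := by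
      induction y using QuotientAddGroup.induction_on with
      | H b =>
        refine ⟨b - round b, by simpa using abs_sub_round b, ?_⟩
        rw [AddCircle.coe_sub, sub_eq_self, AddCircle.coe_eq_zero_iff]
        exact ⟨round b, by simp⟩
    have hn : ‖y‖ ≤ |r| := by
      rw [← hry]
      exact QuotientAddGroup.norm_mk_le_norm
    have hexp : (AddCircle.toCircle y : ℂ) = Complex.exp (Complex.I * ((2 * Real.pi * r : ℝ) : ℂ)) := by
      rw [← hry, AddCircle.toCircle_apply_mk, Circle.coe_exp, div_one, mul_comm]
    rw [hexp, Complex.norm_exp_I_mul_ofReal_sub_one, norm_mul, Real.norm_eq_abs, Real.norm_eq_abs,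
      show 2 * Real.pi * r / 2 = Real.pi * r by ring, abs_two]
    have hsin : 2 * |r| ≤ |Real.sin (Real.pi * r)| := by
      have h1 := Real.mul_abs_le_abs_sin (x := Real.pi * r) (by
        rw [abs_mul, abs_of_pos Real.pi_pos]
        nlinarith [Real.pi_pos])
      rw [abs_mul, abs_of_pos Real.pi_pos] at h1
      have h2 : 2 / Real.pi * (Real.pi * |r|) = 2 * |r| := by
        field_simp
      linarith
    linarith [abs_nonneg r]
  have h := key (s - x)
  have hx : ‖(AddCircle.toCircle x : ℂ)‖ = 1 := Circle.norm_coe _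
  have e : (AddCircle.toCircle s : ℂ) - AddCircle.toCircle x
      = ((AddCircle.toCircle (s - x) : ℂ) - 1) * AddCircle.toCircle x := by
    have : (AddCircle.toCircle s : ℂ) = AddCircle.toCircle (s - x) * AddCircle.toCircle x := by
      rw [← Circle.coe_mul, ← AddCircle.toCircle_add, sub_add_cancel]
    rw [this]
    ring
  rwa [e, norm_mul, hx, mul_one]

/-- With `δ = 1 - ‖z‖` and `d = |s - z|`, the kernel is at most `2δ/d²`, while the Stolz condition
gives `dist s x ≤ (1 + |α|) d`. The index `k` records the dyadic shell of `s` around `x`. -/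
theorem exists_poisson_le {x : UnitAddCircle} {α : ℝ} {z : ℂ}
    (hz : z ∈ stolz (AddCircle.toCircle x : ℂ) α) (s : UnitAddCircle) :
    ∃ k : ℕ, s ∈ Metric.closedBall x (2 ^ k * (1 - ‖z‖)) ∧
      poisson z s ≤ 8 * (1 + |α|) ^ 2 * ((1 / 4) ^ k / (1 - ‖z‖)) := by
  obtain ⟨hz1, hz2⟩ := hz
  set δ := 1 - ‖z‖ with hδ
  have hδ0 : 0 < δ := by linarith
  set d := ‖(AddCircle.toCircle s : ℂ) - z‖ with hd
  have hdδ : δ ≤ d := one_sub_norm_le_norm_toCircle_sub z s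
  have hd0 : 0 < d := by linarith
  have hP : poisson z s ≤ 2 * δ / d ^ 2 := by
    rw [poisson_eq]
    gcongr
    nlinarith [norm_nonneg z]
  have hK : 1 ≤ (1 + |α|) ^ 2 := by nlinarith [abs_nonneg α]
  have hρ : dist s x ≤ (1 + |α|) * d := by
    rw [dist_eq_norm]
    calc ‖s - x‖ ≤ ‖(AddCircle.toCircle s : ℂ) - AddCircle.toCircle x‖ :=
          norm_sub_le_norm_toCircle_sub s x
      _ ≤ d + ‖z - AddCircle.toCircle x‖ := norm_sub_le_norm_sub_add_norm_sub _ _ _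
      _ ≤ d + |α| * δ := by
        gcongr
        exact hz2.trans (by gcongr; exact le_abs_self α)
      _ ≤ d + |α| * d := by gcongr
      _ = (1 + |α|) * d := by ring
  rcases le_or_gt (dist s x) δ with h | h
  · refine ⟨0, by simpa using h, ?_⟩
    calc poisson z s ≤ 2 * δ / d ^ 2 := hP
      _ ≤ 2 * δ / δ ^ 2 := by gcongr
      _ = 2 * 1 * (1 / δ) := by field_simp
      _ ≤ 8 * (1 + |α|) ^ 2 * (1 / δ) := by gcongr; norm_num
      _ = _ := by simp
  · obtain ⟨k, hk1, hk2⟩ := exists_nat_pow_near (x := dist s x / δ) (y := 2)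
      ((one_le_div hδ0).2 h.le) one_lt_two
    rw [le_div_iff₀ hδ0] at hk1
    rw [div_lt_iff₀ hδ0] at hk2
    -- The ball needs the outer radius `2 ^ (k + 1) δ`, the bound on `d` the inner one `2 ^ k δ`;
    -- this loss of 4 turns the constant 2 into 8.
    refine ⟨k + 1, hk2.le, hP.trans ?_⟩
    have h1 : 2 ^ k * δ ≤ (1 + |α|) * d := hk1.trans hρ
    have h2 : (2 ^ k * δ) ^ 2 ≤ ((1 + |α|) * d) ^ 2 := by gcongr
    have h3 : 8 * (1 + |α|) ^ 2 * ((1 / 4) ^ (k + 1) / δ)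
        = 2 * (1 + |α|) ^ 2 / ((2 ^ k) ^ 2 * δ) := by
      have : ((1 : ℝ) / 4) ^ (k + 1) = 1 / (4 * (2 ^ k) ^ 2) := by
        rw [← pow_mul, mul_comm k 2, pow_mul, div_pow, one_pow, pow_succ]
        norm_num
        ring
      rw [this]
      field_simp
      ring
    rw [h3, div_le_div_iff₀ (by positivity) (by positivity)]
    nlinarith [h2]

theorem tendsto_tsum_dyadic {A : ℝ → ℝ} {C : ℝ} (hA0 : ∀ r, 0 < r → 0 ≤ A r)
    (hAC : ∀ r, 0 < r → A r ≤ C) (hA : Tendsto A (𝓝[>] 0) (𝓝 0)) :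
    Tendsto (fun δ : ℝ => ∑' k : ℕ, (1 / 2) ^ k * A (2 ^ k * δ)) (𝓝[>] 0) (𝓝 0) := by
  have h := tendsto_tsum_of_dominated_convergence (𝓕 := 𝓝[>] (0 : ℝ))
    (f := fun (δ : ℝ) (k : ℕ) => ((1 : ℝ) / 2) ^ k * A (2 ^ k * δ)) (g := fun _ => (0 : ℝ))
    (bound := fun k => (1 / 2) ^ k * C) (summable_geometric_two.mul_right C) ?_ ?_
  · simpa using h
  · intro k
    have h1 : Tendsto (fun δ : ℝ => 2 ^ k * δ) (𝓝[>] 0) (𝓝[>] 0) := by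
      refine tendsto_nhdsWithin_iff.2 ⟨?_, ?_⟩
      · have : Tendsto (fun δ : ℝ => 2 ^ k * δ) (𝓝 0) (𝓝 (2 ^ k * 0)) :=
          (continuous_const.mul continuous_id).tendsto 0
        rw [mul_zero] at this
        exact this.mono_left nhdsWithin_le_nhds
      · filter_upwards [self_mem_nhdsWithin] with δ hδ
        have : (0 : ℝ) < δ := hδ
        exact Set.mem_Ioi.2 (by positivity)
    simpa using (hA.comp h1).const_mul ((1 / 2 : ℝ) ^ k)
  · filter_upwards [self_mem_nhdsWithin] with δ hδ k
    have hδ : (0 : ℝ) < δ := hδ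
    have h2 : 0 < 2 ^ k * δ := by positivity
    rw [Real.norm_of_nonneg (mul_nonneg (by positivity) (hA0 _ h2))]
    gcongr
    exact hAC _ h2

/-- The kernel is dominated by a series of indicators of dyadic balls. Writing `(1/4)^k / δ =
(1/2)^k / (2^k δ)` leaves averages of `h` with summable weights. -/
theorem integral_poisson_mul_le {h : UnitAddCircle → ℝ} (h0 : ∀ s, 0 ≤ h s)
    (hint : Integrable h m) {x : UnitAddCircle} {α : ℝ} {z : ℂ}
    (hz : z ∈ stolz (AddCircle.toCircle x : ℂ) α) :
    ∫ s, poisson z s * h s ∂m ≤ 8 * (1 + |α|) ^ 2 * ∑' k : ℕ, (1 / 2) ^ k *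
      ((∫ s in Metric.closedBall x (2 ^ k * (1 - ‖z‖)), h s ∂m) / (2 ^ k * (1 - ‖z‖))) := by
  have hδ0 : 0 < 1 - ‖z‖ := by linarith [hz.1]
  set δ := 1 - ‖z‖ with hδ
  let F : ℕ → UnitAddCircle → ℝ := fun k s =>
    (1 / 4) ^ k / δ * (Metric.closedBall x (2 ^ k * δ)).indicator h s
  have hF0 : ∀ k s, 0 ≤ F k s := fun k s =>
    mul_nonneg (by positivity) (Set.indicator_nonneg (fun s _ => h0 s) s)
  have hFle : ∀ k s, F k s ≤ (1 / 4) ^ k / δ * h s := fun k s =>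
    mul_le_mul_of_nonneg_left (Set.indicator_le_self' (fun s _ => h0 s) s) (by positivity)
  have hgeo : Summable fun k : ℕ => ((1 : ℝ) / 4) ^ k / δ :=
    (summable_geometric_of_lt_one (by norm_num) (by norm_num)).div_const δ
  have hFint : ∀ k, Integrable (F k) m := fun k =>
    (hint.indicator Metric.isClosed_closedBall.measurableSet).const_mul _
  have hFsum : ∀ s, Summable fun k => F k s := fun s =>
    Summable.of_nonneg_of_le (fun k => hF0 k s) (fun k => hFle k s) (hgeo.mul_right _)
  have hFisum : Summable fun k => ∫ s, ‖F k s‖ ∂m := by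
    refine Summable.of_nonneg_of_le (fun k => integral_nonneg fun s => norm_nonneg _)
      (fun k => ?_) (hgeo.mul_right (∫ s, h s ∂m))
    rw [← integral_const_mul]
    refine integral_mono (hFint k).norm (hint.const_mul _) fun s => ?_
    simp only [Real.norm_of_nonneg (hF0 k s)]
    exact hFle k s
  have hsumint : ∑' k, ∫ s, F k s ∂m = ∫ s, ∑' k, F k s ∂m :=
    integral_tsum_of_summable_integral_norm hFint hFisum
  have hterm : ∀ k, ∫ s, F k s ∂m = (1 / 2) ^ k *
      ((∫ s in Metric.closedBall x (2 ^ k * δ), h s ∂m) / (2 ^ k * δ)) := by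
    intro k
    simp only [F]
    rw [integral_const_mul, integral_indicator Metric.isClosed_closedBall.measurableSet]
    have : ((1 : ℝ) / 4) ^ k = (1 / 2) ^ k * (1 / 2 ^ k) := by
      rw [← one_div_pow, ← mul_pow]
      norm_num
    rw [this]
    field_simp
  have hFtint : Integrable (fun s => ∑' k, F k s) m := by
    refine (hint.const_mul (∑' k : ℕ, ((1 : ℝ) / 4) ^ k / δ)).mono' ?_
      (Eventually.of_forall fun s => ?_)
    · refine aestronglyMeasurable_of_tendsto_ae (u := atTop)
        (f := fun n s => ∑ k ∈ Finset.range n, F k s) (fun n => ?_)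
        (Eventually.of_forall fun s => (hFsum s).hasSum.tendsto_sum_nat)
      exact (integrable_finsetSum _ fun k _ => hFint k).aestronglyMeasurable
    · rw [Real.norm_of_nonneg (tsum_nonneg fun k => hF0 k s), ← tsum_mul_right]
      exact (hFsum s).tsum_le_tsum (fun k => hFle k s) (hgeo.mul_right _)
  simp only [← hterm]
  rw [hsumint, ← integral_const_mul]
  refine integral_mono_of_nonneg
    (Eventually.of_forall fun s => mul_nonneg (poisson_nonneg hz.1 s) (h0 s))
    (hFtint.const_mul _) (Eventually.of_forall fun s => ?_)
  obtain ⟨k, hk1, hk2⟩ := exists_poisson_le hz s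
  calc poisson z s * h s ≤ 8 * (1 + |α|) ^ 2 * ((1 / 4) ^ k / δ) * h s := by
        gcongr
        exact h0 s
    _ = 8 * (1 + |α|) ^ 2 * F k s := by
        simp only [F]
        rw [Set.indicator_of_mem hk1]
        ring
    _ ≤ 8 * (1 + |α|) ^ 2 * ∑' k, F k s := by
        gcongr
        exact (hFsum s).le_tsum k fun j _ => hF0 j s

theorem tendsto_integral_poisson_mul {h : UnitAddCircle → ℝ} (h0 : ∀ s, 0 ≤ h s)
    (hint : Integrable h m) {x : UnitAddCircle}
    (hA : Tendsto (fun r => (∫ s in Metric.closedBall x r, h s ∂m) / r) (𝓝[>] 0) (𝓝 0)) (α : ℝ) :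
    Tendsto (fun z => ∫ s, poisson z s * h s ∂m)
      (𝓝[stolz (AddCircle.toCircle x : ℂ) α] (AddCircle.toCircle x : ℂ)) (𝓝 0) := by
  have hA0 : ∀ r, 0 < r → 0 ≤ (∫ s in Metric.closedBall x r, h s ∂m) / r := fun r hr =>
    div_nonneg (integral_nonneg h0) hr.le
  -- Dominated convergence in the dyadic sum needs a bound at all radii: small ones by the limit,
  -- large ones by the total integral.
  obtain ⟨C, hC⟩ : ∃ C, ∀ r, 0 < r → (∫ s in Metric.closedBall x r, h s ∂m) / r ≤ C := by
    obtain ⟨ε, hε, hε2⟩ := mem_nhdsGT_iff_exists_Ioo_subset.1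
      (hA.eventually (eventually_lt_nhds (zero_lt_one' ℝ)))
    have hε : 0 < ε := hε
    refine ⟨max 1 ((∫ s, h s ∂m) / ε), fun r hr => ?_⟩
    rcases lt_or_ge r ε with h1 | h1
    · exact le_max_of_le_left (le_of_lt (hε2 ⟨hr, h1⟩))
    · refine le_max_of_le_right ?_
      have h2 : ∫ s in Metric.closedBall x r, h s ∂m ≤ ∫ s, h s ∂m :=
        setIntegral_le_integral hint (Eventually.of_forall h0)
      have h3 : 0 ≤ ∫ s, h s ∂m := integral_nonneg h0
      gcongr
  have hδ : Tendsto (fun z : ℂ => 1 - ‖z‖)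
      (𝓝[stolz (AddCircle.toCircle x : ℂ) α] (AddCircle.toCircle x : ℂ)) (𝓝[>] 0) := by
    refine tendsto_nhdsWithin_iff.2 ⟨?_, ?_⟩
    · have h1 : Tendsto (fun z : ℂ => 1 - ‖z‖) (𝓝 (AddCircle.toCircle x : ℂ))
          (𝓝 (1 - ‖(AddCircle.toCircle x : ℂ)‖)) :=
        (continuous_const.sub continuous_norm).tendsto _
      rw [Circle.norm_coe, sub_self] at h1
      exact h1.mono_left nhdsWithin_le_nhds
    · filter_upwards [self_mem_nhdsWithin] with z hz
      exact Set.mem_Ioi.2 (by linarith [hz.1])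
  have hlim := ((tendsto_tsum_dyadic hA0 hC hA).comp hδ).const_mul (8 * (1 + |α|) ^ 2)
  rw [mul_zero] at hlim
  refine tendsto_of_tendsto_of_tendsto_of_le_of_le' tendsto_const_nhds hlim ?_ ?_
  · filter_upwards [self_mem_nhdsWithin] with z hz
    exact integral_nonneg fun s => mul_nonneg (poisson_nonneg hz.1 s) (h0 s)
  · filter_upwards [self_mem_nhdsWithin] with z hz
    exact integral_poisson_mul_le h0 hint hz

theorem ae_tendsto_setIntegral_closedBall_div {g : UnitAddCircle → ℂ} (hg : Integrable g m) :
    ∀ᵐ x ∂m, Tendsto (fun r => (∫ s in Metric.closedBall x r, ‖g s - g x‖ ∂m) / r)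
      (𝓝[>] 0) (𝓝 0) := by
  have hvol : (volume : Measure UnitAddCircle) = m := by
    rw [AddCircle.volume_eq_smul_haarAddCircle, ENNReal.ofReal_one, one_smul]
  have hg' : Integrable g (volume : Measure UnitAddCircle) := by rwa [hvol]
  rw [← hvol]
  filter_upwards [IsUnifLocDoublingMeasure.ae_tendsto_average_norm_sub
    (volume : Measure UnitAddCircle) hg'.locallyIntegrable 1] with x hx
  have h1 := hx (l := 𝓝[>] (0 : ℝ)) (fun _ => x) id tendsto_id (by
    filter_upwards [self_mem_nhdsWithin] with r hr
    have : (0 : ℝ) < r := hr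
    simpa using this.le)
  have h2 := h1.const_mul 2
  rw [mul_zero] at h2
  refine tendsto_of_tendsto_of_tendsto_of_le_of_le' tendsto_const_nhds h2 ?_ ?_
  · filter_upwards [self_mem_nhdsWithin] with r hr
    exact div_nonneg (integral_nonneg fun _ => norm_nonneg _) (le_of_lt hr)
  · filter_upwards [self_mem_nhdsWithin] with r hr
    have hr : (0 : ℝ) < r := hr
    have hmeas : (volume : Measure UnitAddCircle).real (Metric.closedBall x r) = min 1 (2 * r) := by
      rw [measureReal_def, AddCircle.volume_closedBall, ENNReal.toReal_ofReal (by positivity)]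
    simp only [id]
    rw [setAverage_eq, hmeas, smul_eq_mul]
    have hmin : 0 < min 1 (2 * r) := by positivity
    have hI : 0 ≤ ∫ s in Metric.closedBall x r, ‖g s - g x‖ := integral_nonneg fun _ => norm_nonneg _
    -- A ball has measure at most `2r`, so division by `r` costs a factor 2 against the average.
    have : r⁻¹ ≤ 2 * (min 1 (2 * r))⁻¹ := by
      rw [← div_eq_mul_inv, inv_eq_one_div, div_le_div_iff₀ hr hmin]
      linarith [min_le_right 1 (2 * r)]
    rw [div_eq_mul_inv, mul_comm, ← mul_assoc]
    gcongr

/-- **Fatou's theorem**: the Poisson integral of an integrable function `g` has the non-tangential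
limit `g` almost everywhere. -/
theorem ae_tendsto_integral_poisson_mul {g : UnitAddCircle → ℂ} (hg : Integrable g m) :
    ∀ᵐ x ∂m, ∀ α : ℝ, Tendsto (fun z => ∫ s, (poisson z s : ℂ) * g s ∂m)
      (𝓝[stolz (AddCircle.toCircle x : ℂ) α] (AddCircle.toCircle x : ℂ)) (𝓝 (g x)) := by
  filter_upwards [ae_tendsto_setIntegral_closedBall_div hg] with x hx α
  have hint : Integrable (fun s => g s - g x) m := hg.sub (integrable_const _)
  have h := tendsto_integral_poisson_mul (fun s => norm_nonneg (g s - g x)) hint.norm hx α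
  rw [tendsto_iff_norm_sub_tendsto_zero]
  refine tendsto_of_tendsto_of_tendsto_of_le_of_le' tendsto_const_nhds h
    (Eventually.of_forall fun _ => norm_nonneg _) ?_
  filter_upwards [self_mem_nhdsWithin] with z hz
  have hPc : Continuous fun s => (poisson z s : ℂ) :=
    Complex.continuous_ofReal.comp (continuous_poisson hz.1)
  obtain ⟨B, hB⟩ := (isCompact_range hPc).isBounded.exists_norm_le
  have hmul : ∀ f : UnitAddCircle → ℂ, Integrable f m →
      Integrable (fun s => (poisson z s : ℂ) * f s) m := fun f hf =>
    hf.bdd_mul hPc.aestronglyMeasurable (Eventually.of_forall fun s => hB _ ⟨s, rfl⟩)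
  -- The Poisson kernel has mass one, so the constant `g x` can be moved under the integral.
  have hone : ∫ s, (poisson z s : ℂ) * g x ∂m = g x :=
    integral_poisson_smul (F := fun _ => g x) (diffContOnCl_const) hz.1
  have hdiff : (∫ s, (poisson z s : ℂ) * g s ∂m) - g x
      = ∫ s, (poisson z s : ℂ) * (g s - g x) ∂m := by
    conv_lhs => rw [← hone]
    rw [← integral_sub (hmul _ hg) (hmul _ (integrable_const _))]
    simp only [mul_sub]
  rw [hdiff]
  refine (norm_integral_le_integral_norm _).trans (le_of_eq ?_)
  refine integral_congr_ae (Eventually.of_forall fun s => ?_)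
  simp only [norm_mul, Complex.norm_real, Real.norm_of_nonneg (poisson_nonneg hz.1 s)]

/-! ### Convergence of the partial Blaschke products on the circle -/

/-- The partial Blaschke product on the circle as an element of `L²(𝕋)`. -/
def partialBlaschkeL2 {c : ℕ → ℂ} (hc : ∀ k, ‖c k‖ < 1) (n : ℕ) : L2 :=
  ContinuousMap.toLp 2 m ℂ (partialBlaschkeCircle hc n)

/-- The partial Blaschke product on the circle as an element of `L^∞(𝕋)`. -/
def partialBlaschkeLinf {c : ℕ → ℂ} (hc : ∀ k, ‖c k‖ < 1) (n : ℕ) : Linf :=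
  ContinuousMap.toLp ⊤ m ℂ (partialBlaschkeCircle hc n)

/-- Unimodularity cancels the first `n` factors; the mean value property evaluates the rest at 0,
where `b_c(0) = |c|`. -/
theorem inner_partialBlaschkeL2 {c : ℕ → ℂ} (hc : ∀ k, ‖c k‖ < 1) {n p : ℕ} (hnp : n ≤ p) :
    inner ℂ (partialBlaschkeL2 hc n) (partialBlaschkeL2 hc p)
      = ((∏ k ∈ Finset.Ico n p, ‖c k‖ : ℝ) : ℂ) := by
  have hF : DiffContOnCl ℂ (fun z => ∏ k ∈ Finset.Ico n p, blaschkeFactor (c k) z)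
      (Metric.ball 0 1) :=
    diffContOnCl_of_differentiableAt fun z hz =>
      DifferentiableAt.fun_finsetProd fun k _ => differentiableAt_blaschkeFactor (hc k) hz
  have h := integral_toCircle_of_diffContOnCl hF
  simp only [blaschkeFactor_zero_right] at h
  rw [Complex.ofReal_prod, ← h, partialBlaschkeL2, partialBlaschkeL2, ContinuousMap.inner_toLp]
  refine integral_congr_ae (Eventually.of_forall fun x => ?_)
  set t : ℂ := (AddCircle.toCircle x : ℂ) with ht
  have hnorm : partialBlaschke c n t * (starRingEnd ℂ) (partialBlaschke c n t) = 1 := by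
    rw [Complex.mul_conj, Complex.normSq_eq_norm_sq, norm_partialBlaschke hc n (Circle.norm_coe _)]
    simp
  have hprod : partialBlaschke c p t
      = partialBlaschke c n t * ∏ k ∈ Finset.Ico n p, blaschkeFactor (c k) t :=
    (Finset.prod_range_mul_prod_Ico _ hnp).symm
  change partialBlaschke c p t * (starRingEnd ℂ) (partialBlaschke c n t) = _
  rw [hprod]
  linear_combination (∏ k ∈ Finset.Ico n p, blaschkeFactor (c k) t) * hnorm

theorem one_sub_sum_one_sub_le_prod {ι : Type*} (s : Finset ι) {a : ι → ℝ} (h0 : ∀ i, 0 ≤ a i)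
    (h1 : ∀ i, a i ≤ 1) : 1 - ∑ i ∈ s, (1 - a i) ≤ ∏ i ∈ s, a i := by
  classical
  induction s using Finset.induction_on with
  | empty => simp
  | insert i s hi ih =>
    rw [Finset.sum_insert hi, Finset.prod_insert hi]
    have hp0 : 0 ≤ ∏ i ∈ s, a i := Finset.prod_nonneg fun j _ => h0 j
    have hp1 : ∏ i ∈ s, a i ≤ 1 := Finset.prod_le_one (fun j _ => h0 j) fun j _ => h1 j
    nlinarith [h0 i, h1 i]

theorem norm_partialBlaschkeL2_sub_sq_le {c : ℕ → ℂ} (hc : ∀ k, ‖c k‖ < 1) {n p : ℕ}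
    (hnp : n ≤ p) : ‖partialBlaschkeL2 hc n - partialBlaschkeL2 hc p‖ ^ 2
      ≤ 2 * ∑ k ∈ Finset.Ico n p, (1 - ‖c k‖) := by
  have hself : ∀ n, ‖partialBlaschkeL2 hc n‖ ^ 2 = 1 := by
    intro n
    rw [← inner_self_eq_norm_sq (𝕜 := ℂ), inner_partialBlaschkeL2 hc le_rfl]
    simp
  rw [norm_sub_sq (𝕜 := ℂ), hself, hself, inner_partialBlaschkeL2 hc hnp]
  have h := one_sub_sum_one_sub_le_prod (Finset.Ico n p) (fun k => norm_nonneg (c k))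
    (fun k => (hc k).le)
  rw [RCLike.re_eq_complex_re, Complex.ofReal_re]
  linarith

theorem cauchySeq_partialBlaschkeL2 {c : ℕ → ℂ} (hc : ∀ k, ‖c k‖ < 1)
    (hs : Summable fun k => 1 - ‖c k‖) : CauchySeq (partialBlaschkeL2 hc) := by
  have hb := ((tendsto_sum_nat_add fun k => 1 - ‖c k‖).const_mul 2).sqrt
  rw [mul_zero, Real.sqrt_zero] at hb
  refine cauchySeq_of_le_tendsto_0' _ (fun n p hnp => ?_) hb
  rw [dist_eq_norm]
  refine Real.le_sqrt_of_sq_le ((norm_partialBlaschkeL2_sub_sq_le hc hnp).trans ?_)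
  gcongr
  rw [Finset.sum_Ico_eq_sum_range]
  simp only [add_comm n]
  exact ((summable_nat_add_iff n).2 hs).sum_le_tsum _ fun k _ => by linarith [hc (k + n)]

theorem exists_tendsto_partialBlaschkeLinf {c : ℕ → ℂ} (hc : ∀ k, ‖c k‖ < 1)
    (hs : Summable fun k => 1 - ‖c k‖) :
    ∃ g : Linf, Tendsto (fun n => eLpNorm (partialBlaschkeLinf hc n - g : Linf) 2 m) atTop (𝓝 0) ∧
      ∀ f : C(UnitAddCircle, ℂ), Tendsto
        (fun n => ∫ x, f x * partialBlaschke c n (AddCircle.toCircle x : ℂ) ∂m) atTop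
        (𝓝 (∫ x, f x * g x ∂m)) := by
  obtain ⟨G, hG⟩ := cauchySeq_tendsto_of_complete (cauchySeq_partialBlaschkeL2 hc hs)
  have hbound : ∀ᵐ x ∂m, ‖G x‖ ≤ 1 := by
    -- An almost everywhere convergent subsequence transfers the bound 1 to the L² limit.
    obtain ⟨ns, -, hns⟩ := (tendstoInMeasure_of_tendsto_Lp hG).exists_seq_tendsto_ae
    have hV : ∀ᵐ x ∂m, ∀ n, partialBlaschkeL2 hc n x = partialBlaschkeCircle hc n x :=
      ae_all_iff.2 fun n => ContinuousMap.coeFn_toLp (p := 2) (𝕜 := ℂ) m _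
    filter_upwards [hns, hV] with x h1 h2
    refine le_of_tendsto h1.norm (Eventually.of_forall fun n => ?_)
    rw [h2]
    exact (norm_partialBlaschke hc _ (Circle.norm_coe _)).le
  have hmem : MemLp G ⊤ m := memLp_top_of_bound (Lp.aestronglyMeasurable G) 1 hbound
  have hg : (hmem.toLp G : UnitAddCircle → ℂ) =ᵐ[m] G := hmem.coeFn_toLp
  refine ⟨hmem.toLp G, ?_, fun f => ?_⟩
  · refine ((Lp.tendsto_Lp_iff_tendsto_eLpNorm' _ _).1 hG).congr fun n => ?_
    refine eLpNorm_congr_ae ?_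
    filter_upwards [Lp.coeFn_sub (partialBlaschkeLinf hc n) (hmem.toLp G), hg,
      ContinuousMap.coeFn_toLp (p := 2) (𝕜 := ℂ) m (partialBlaschkeCircle hc n),
      ContinuousMap.coeFn_toLp (p := ⊤) (𝕜 := ℂ) m (partialBlaschkeCircle hc n)] with x h1 h2 h3 h4
    rw [h1, Pi.sub_apply, Pi.sub_apply, h2, partialBlaschkeL2, h3, partialBlaschkeLinf, h4]
  · have h1 : Tendsto (fun n => inner ℂ (ContinuousMap.toLp 2 m ℂ (star f) : L2)
        (partialBlaschkeL2 hc n)) atTop (𝓝 (inner ℂ (ContinuousMap.toLp 2 m ℂ (star f) : L2) G)) :=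
      tendsto_const_nhds.inner hG
    have h2 : inner ℂ (ContinuousMap.toLp 2 m ℂ (star f) : L2) G
        = ∫ x, f x * hmem.toLp G x ∂m := by
      rw [L2.inner_def]
      refine integral_congr_ae ?_
      filter_upwards [hg, ContinuousMap.coeFn_toLp (p := 2) (𝕜 := ℂ) m (star f)] with x h1 h2
      rw [h1, h2]
      simp [mul_comm]
    rw [h2] at h1
    refine h1.congr fun n => ?_
    rw [partialBlaschkeL2, ContinuousMap.inner_toLp]
    refine integral_congr_ae (Eventually.of_forall fun x => ?_)
    simp only [ContinuousMap.star_apply, RCLike.star_def, Complex.conj_conj]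
    rw [mul_comm]
    rfl

theorem exists_isBoundaryFunction_blaschke {c : ℕ → ℂ} (hc : ∀ k, ‖c k‖ < 1)
    (hs : Summable fun k => 1 - ‖c k‖) :
    ∃ g : Linf, IsBoundaryFunction (blaschke c) g ∧
      Tendsto (fun n => eLpNorm (partialBlaschkeLinf hc n - g : Linf) 2 m) atTop (𝓝 0) := by
  obtain ⟨g, hg, hint⟩ := exists_tendsto_partialBlaschkeLinf hc hs
  refine ⟨g, ?_, hg⟩
  have hpoisson : ∀ z, ‖z‖ < 1 → ∫ x, (poisson z x : ℂ) * g x ∂m = blaschke c z := by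
    intro z hz
    have h1 := hint ⟨fun x => (poisson z x : ℂ),
      Complex.continuous_ofReal.comp (continuous_poisson hz)⟩
    have h2 := (hasProd_blaschke hc hs hz).tendsto_prod_nat
    -- The Poisson integrals of the partial products, which equal `u_n(z)`, have both sides as
    -- limits.
    refine tendsto_nhds_unique h1 (h2.congr fun n => ?_)
    exact (integral_poisson_smul (diffContOnCl_of_differentiableAt fun w hw =>
      differentiableAt_partialBlaschke hc n hw) hz).symm
  have hgint : Integrable g m := (Lp.memLp g).integrable le_top
  filter_upwards [ae_tendsto_integral_poisson_mul hgint] with x hx α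
  refine (hx α).congr' ?_
  filter_upwards [self_mem_nhdsWithin] with z hz
  exact hpoisson z hz.1

theorem norm_partialBlaschkeLinf_le {c : ℕ → ℂ} (hc : ∀ k, ‖c k‖ < 1) (n : ℕ) :
    ‖partialBlaschkeLinf hc n‖ ≤ 1 := by
  refine Lp.norm_le_of_ae_bound (μ := m) (p := ⊤) (C := 1) (by norm_num) ?_ |>.trans (by simp)
  filter_upwards [ContinuousMap.coeFn_toLp (p := ⊤) (𝕜 := ℂ) m (partialBlaschkeCircle hc n)]
    with x hx
  rw [partialBlaschkeLinf, hx]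
  exact (norm_partialBlaschke hc n (Circle.norm_coe _)).le

theorem R_partialBlaschkeLinf {c : ℕ → ℂ} (hc : ∀ k, ‖c k‖ < 1) (n : ℕ) :
    R (partialBlaschkeLinf hc n) = extend (hankel (partialBlaschkeLinf hc n)) := by
  refine R_eq_extend_hankel ?_ fun f hf =>
    mulOp_mem_H2 (fun k hk => mulOp_partialBlaschke_fourierLp_mem_H2 hc n hk) hf
  filter_upwards [ContinuousMap.coeFn_toLp (p := ⊤) (𝕜 := ℂ) m (partialBlaschkeCircle hc n)]
    with x hx
  rw [partialBlaschkeLinf, hx]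
  exact norm_partialBlaschke hc n (Circle.norm_coe _)

end

end HankelBlaschke

theorem theorem3 :
    (∀ c : ℕ → ℂ, (∀ k, ‖c k‖ < 1) → Summable (fun k => 1 - ‖c k‖) →
      -- the infinite product converges in the disk, and the boundary functions exist
      (∀ z : ℂ, ‖z‖ < 1 →
        HasProd (fun k => HankelBlaschke.blaschkeFactor (c k) z) (HankelBlaschke.blaschke c z)) ∧
      HankelBlaschke.IsBoundaryFunction (HankelBlaschke.blaschke c)
        (HankelBlaschke.boundaryFunction (HankelBlaschke.blaschke c)) ∧
      (∀ n, HankelBlaschke.IsBoundaryFunction (HankelBlaschke.partialBlaschke c n)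
        (HankelBlaschke.boundaryFunction (HankelBlaschke.partialBlaschke c n))) ∧
      -- `R_{u_n}` on `L²(𝕋)` is the Hankel operator `H(u_n)` on `H²`
      (∀ n, HankelBlaschke.R
          (HankelBlaschke.boundaryFunction (HankelBlaschke.partialBlaschke c n)) =
        HankelBlaschke.extend (HankelBlaschke.hankel
          (HankelBlaschke.boundaryFunction (HankelBlaschke.partialBlaschke c n)))) ∧
      -- `H(u_n) → H(u)` *-strongly on `H²`, and `R_{u_n} → H(u)` *-strongly on `L²(𝕋)`
      HankelBlaschke.TendstoStarStrongly
        (fun n => HankelBlaschke.hankel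
          (HankelBlaschke.boundaryFunction (HankelBlaschke.partialBlaschke c n)))
        (HankelBlaschke.hankel
          (HankelBlaschke.boundaryFunction (HankelBlaschke.blaschke c))) ∧
      HankelBlaschke.TendstoStarStrongly
        (fun n => HankelBlaschke.R
          (HankelBlaschke.boundaryFunction (HankelBlaschke.partialBlaschke c n)))
        (HankelBlaschke.extend (HankelBlaschke.hankel
          (HankelBlaschke.boundaryFunction (HankelBlaschke.blaschke c))))) ∧
    -- the classical `R_n = H(t ^ n)` tend weakly to zero
    HankelBlaschke.TendstoWeakly
      (fun n : ℕ => HankelBlaschke.hankel (HankelBlaschke.monomial (n : ℤ))) 0 := by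
  refine ⟨fun c hc hs => ?_, HankelBlaschke.tendstoWeakly_hankel_monomial⟩
  obtain ⟨g, hg, hlim⟩ := HankelBlaschke.exists_isBoundaryFunction_blaschke hc hs
  have hpart := fun n => HankelBlaschke.isBoundaryFunction_partialBlaschke hc n
  have hb : HankelBlaschke.boundaryFunction (HankelBlaschke.blaschke c) = g :=
    HankelBlaschke.boundaryFunction_eq hg
  have hbn : ∀ n, HankelBlaschke.boundaryFunction (HankelBlaschke.partialBlaschke c n)
      = HankelBlaschke.partialBlaschkeLinf hc n :=
    fun n => HankelBlaschke.boundaryFunction_eq (hpart n)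
  have hR := HankelBlaschke.R_partialBlaschkeLinf hc
  have hstar := HankelBlaschke.tendstoStarStrongly_hankel
    (HankelBlaschke.norm_partialBlaschkeLinf_le hc) hlim
  simp only [hb, hbn, hR]
  exact ⟨fun z hz => HankelBlaschke.hasProd_blaschke hc hs hz, hg, hpart, fun _ => trivial, hstar,
    hstar.extend⟩
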